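/- Let $q$ be a prime power, let $n,k$ be positive integers and let $j$ be a nonnegative integer. Assume the MDS conjecture over $\mathbb F_q$: if there is a nontrivial $[n',k',d']_q$ MDS code (a linear MDS code which is neither $\mathbb F_q^{n'}$ nor monomially equivalent to the repetition code or to its dual), then $n'\le q+1$, except when $q$ is even and $k'\in\{3,q-1\}$, in which case $n'\le q+2$. For linear codes $C_1,C_2\subseteq\mathbb F_q^n$ with minimum distances $d_1,d_2$, with $C_1^\perp\subseteq C_2$ (Euclidean dual) and $\dim C_1+\dim C_2=n+j$, let $d_z$ and $d_x$ be the maximum and the minimum of the two numbers $\mathrm{wt}(C_2\setminus C_1^\perp)$, $\mathrm{wt}(C_1\setminus C_2^\perp)$, where $\mathrm{wt}$ of a set is its smallest Hamming weight; if $j=0$ (so that $C_1^\perp=C_2$) the two numbers are understood to be $d_2$ and $d_1$. The span in $(\mathbb C^q)^{\otimes n}$ of the states $\sum_{c\in C_1^\perp}|x+c\rangle$, $x\in C_2$ (or the same with $C_1$ and $C_2$ interchanged), is a CSS code with parameters $[[n,j,d_z/d_x]]_q$ if it has dimension $q^j$ and detects $d_x-1$ qudits of $X$-errors and, at the same time,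 $d_z-1$ qudits of $Z$-errors; a code of dimension one is, by convention, also required to be pure, i.e. every nontrivial error $X(a)Z(b)$ with $\mathrm{wt}(a)\le d_x-1$ and $\mathrm{wt}(b)\le d_z-1$ maps it into its orthogonal complement. A CSS code is called pure if $\{d_z,d_x\}=\{d_1,d_2\}$, and AQMDS if $j=n-d_x-d_z+2$. Then there exists a pure CSS AQMDS code with parameters $[[n,j,d_z/d_x]]_q$, where $\{d_z,d_x\}=\{n-k-j+1,k+1\}$, if and only if one of the following holds: 1. $n\ge 2$, $k\in\{1,n-1\}$, and $j\in\{0,n-k\}$. 2. $q=2$, $n$ is even, $k=1$, and $j=n-2$. 3. $q\ge 3$, $n\ge 2$, $k=1$, and $j=n-2$. 4. $q\ge 3$, $2\le n\le q$, $k\le n-1$, and $0\le j\le n-k$. 5. $q\ge 3$, $n=q+1$, $k\le n-1$, and either $j=0$ or $2\le j\le n-k$. 6. $q=2^m$ with $m\ge 1$, $n=q+1$, $j=1$, and $k\in\{2,2^m-2\}$. 7. $q=2^m$ with $m\ge 2$, $n=q+2$, and either $k=1$ and $j\in\{2,2^m-2\}$; or $k=3$ and $j\in\{0,2^m-4,2^m-2,2^m-1\}$;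 or $k=2^m-1$ and $j\in\{0,2,3\}$. -/

import Mathlib

/-! ### Classical linear codes -/

/-- The dual `C^⊥` of a code `C ⊆ F^n` for the Euclidean inner product. -/
def dualCode {F : Type*} [Field F] {n : ℕ} (C : Submodule F (Fin n → F)) :
    Submodule F (Fin n → F) where
  carrier := {u | ∀ v ∈ C, u ⬝ᵥ v = 0}
  add_mem' := fun {a b} ha hb v hv => by rw [add_dotProduct, ha v hv, hb v hv, add_zero]
  zero_mem' := fun v _ => zero_dotProduct v
  smul_mem' := fun c x hx v hv => by rw [smul_dotProduct, hx v hv, smul_zero]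

open Classical in
/-- `d` is the minimum Hamming weight of the vectors in `S` (never true for empty `S`). -/
def IsMinWeight {F : Type*} [Field F] {n : ℕ} (S : Set (Fin n → F)) (d : ℕ) : Prop :=
  IsLeast (hammingNorm '' S) d

/-- `d` is the minimum distance of the linear code `C`. -/
def HasMinDist {F : Type*} [Field F] {n : ℕ} (C : Submodule F (Fin n → F)) (d : ℕ) : Prop :=
  IsMinWeight {v | v ∈ C ∧ v ≠ 0} d

/-- `C` is an `[n, k, d]` MDS code: `dim C = k` and the minimum distance is `d = n - k + 1`. -/
def IsMDS {F : Type*} [Field F] {n : ℕ} (C : Submodule F (Fin n → F)) : Prop :=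
  ∃ d : ℕ, HasMinDist C d ∧ d + Module.finrank F C = n + 1

/-- Monomial equivalence: `D` arises from `C` by permuting the coordinates and multiplying them
by nonzero scalars. -/
def CodeEquiv {F : Type*} [Field F] {n : ℕ} (C D : Submodule F (Fin n → F)) : Prop :=
  ∃ (σ : Equiv.Perm (Fin n)) (a : Fin n → Fˣ),
    ∀ x : Fin n → F, x ∈ C ↔ (fun i => (a i : F) * x (σ i)) ∈ D

/-- The repetition code. -/
def repetitionCode (F : Type*) [Field F] (n : ℕ) : Submodule F (Fin n → F) :=
  Submodule.span F {fun _ => (1 : F)}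

/-- The trivial MDS codes: the full space, the codes equivalent to the repetition code, and the
codes equivalent to its dual. -/
def IsTrivialCode {F : Type*} [Field F] {n : ℕ} (C : Submodule F (Fin n → F)) : Prop :=
  C = ⊤ ∨ CodeEquiv C (repetitionCode F n) ∨ CodeEquiv C (dualCode (repetitionCode F n))

/-- The MDS conjecture over the finite field `F` with `q` elements: a nontrivial `[n, k, d]` MDS
code over `F` has `n ≤ q + 1`, except when `q` is even and `k = 3` or `k = q - 1`, in which case
`n ≤ q + 2`. -/
def MDSConjecture (F : Type*) [Field F] [Fintype F] : Prop :=
  ∀ (n k : ℕ) (C : Submodule F (Fin n → F)),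
    IsMDS C → ¬ IsTrivialCode C → Module.finrank F C = k →
      ((Even (Fintype.card F) ∧ (k = 3 ∨ k = Fintype.card F - 1)) → n ≤ Fintype.card F + 2) ∧
      (¬ (Even (Fintype.card F) ∧ (k = 3 ∨ k = Fintype.card F - 1)) → n ≤ Fintype.card F + 1)

/-! ### Quantum codes -/

/-- The space `(ℂ^q)^{⊗ n}` of `n` qudits, as the Hilbert space with orthonormal basis
`|x⟩`, `x ∈ F^n`, where `F` has `q` elements. -/
abbrev QuditSpace (F : Type*) [Field F] [Fintype F] (n : ℕ) : Type _ :=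
  EuclideanSpace ℂ (Fin n → F)

/-- The error `X(a) Z(b)`, where `X(a) |x⟩ = |x + a⟩` and `Z(b) |x⟩ = χ(b · x) |x⟩`, applied to a
state `φ`. Here `χ` is a nontrivial additive character of `F`, that is,
`χ(y) = exp(2πi Tr(c y) / p)` for some `c ≠ 0`, where `p` is the characteristic. -/
def errorOp {F : Type*} [Field F] [Fintype F] {n : ℕ} (χ : AddChar F ℂ) (a b : Fin n → F)
    (φ : QuditSpace F n) : QuditSpace F n :=
  WithLp.toLp 2 (fun x => χ (b ⬝ᵥ (x - a)) * φ (x - a))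

open Classical in
/-- `Q` is an asymmetric quantum code `[[n, j, dz/dx]]_q`: it has dimension `q ^ j` and detects
`dx - 1` qudits of `X`-errors and, at the same time, `dz - 1` qudits of `Z`-errors. Detection of
`E` means `P E P = c P` for a scalar `c`, where `P` is the orthogonal projection onto `Q`. By the
usual convention a code of dimension one is moreover required to be pure. The sets of errors are
the same for all choices of the nontrivial character `χ`. -/
structure IsAQC {F : Type*} [Field F] [Fintype F] {n : ℕ} (Q : Submodule ℂ (QuditSpace F n))
    (j dz dx : ℕ) : Prop where
  one_le_dx : 1 ≤ dx
  one_le_dz : 1 ≤ dz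
  dim_eq : Module.finrank ℂ Q = Fintype.card F ^ j
  detects : ∀ χ : AddChar F ℂ, χ ≠ 1 → ∀ a b : Fin n → F,
    hammingNorm a ≤ dx - 1 → hammingNorm b ≤ dz - 1 →
      ∃ c : ℂ, ∀ φ ∈ Q, ∀ ψ ∈ Q, inner ℂ φ (errorOp χ a b ψ) = c * inner ℂ φ ψ
  pure_of_dim_one : j = 0 → ∀ χ : AddChar F ℂ, χ ≠ 1 → ∀ a b : Fin n → F,
    hammingNorm a ≤ dx - 1 → hammingNorm b ≤ dz - 1 → (a ≠ 0 ∨ b ≠ 0) →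
      ∀ φ ∈ Q, ∀ ψ ∈ Q, inner ℂ φ (errorOp χ a b ψ) = 0

/-- The (unnormalized) coset state `∑_{c ∈ D} |x + c⟩`. -/
noncomputable def cosetState {F : Type*} [Field F] [Fintype F] {n : ℕ}
    (D : Submodule F (Fin n → F)) (x : Fin n → F) : QuditSpace F n :=
  WithLp.toLp 2 (Set.indicator {y | y - x ∈ D} (fun _ => (1 : ℂ)))

/-- The CSS code of `C₁^⊥ ⊆ C₂`, spanned by the states `∑_{c ∈ C₁^⊥} |x + c⟩` with `x ∈ C₂`. -/
noncomputable def cssCode {F : Type*} [Field F] [Fintype F] {n : ℕ}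
    (C₁ C₂ : Submodule F (Fin n → F)) : Submodule ℂ (QuditSpace F n) :=
  Submodule.span ℂ (cosetState (dualCode C₁) '' (C₂ : Set (Fin n → F)))

/-- `w = wt(C \ D)`. If `C = D` (quantum codes of dimension one), the usual convention is that
`w` is the minimum distance of `C`. -/
def HasCosetWeight {F : Type*} [Field F] {n : ℕ} (C D : Submodule F (Fin n → F)) (w : ℕ) : Prop :=
  (C ≠ D ∧ IsMinWeight {v | v ∈ C ∧ v ∉ D} w) ∨ (C = D ∧ HasMinDist C w)

/-- `Q` is an asymmetric quantum code `[[n, k₁ + k₂ - n, dz/dx]]_q` obtained from the linear codes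
`C₁` and `C₂`, of dimensions `k₁` and `k₂`, by the CSS construction. The two codes may be
interchanged, so that the larger one of the two distances belongs to the `Z`-errors. -/
structure IsCSS {F : Type*} [Field F] [Fintype F] {n : ℕ} (C₁ C₂ : Submodule F (Fin n → F))
    (Q : Submodule ℂ (QuditSpace F n)) (j dz dx : ℕ) : Prop where
  dual_le : dualCode C₁ ≤ C₂
  dim_eq : Module.finrank F C₁ + Module.finrank F C₂ = n + j
  dist_eq : ∃ w₁ w₂ : ℕ, HasCosetWeight C₂ (dualCode C₁) w₂ ∧ HasCosetWeight C₁ (dualCode C₂) w₁ ∧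
    dz = max w₂ w₁ ∧ dx = min w₂ w₁
  code_eq : Q = cssCode C₁ C₂ ∨ Q = cssCode C₂ C₁
  isAQC : IsAQC Q j dz dx

/-- `Q` is a pure CSS AQMDS code `[[n, j, dz/dx]]_q`: it comes from the CSS construction, the set
`{dz, dx}` is the set of the minimum distances of the two classical codes (purity), and the quantum
Singleton bound `j ≤ n - dx - dz + 2` is attained. -/
def IsPureCSSAQMDS {F : Type*} [Field F] [Fintype F] {n : ℕ} (Q : Submodule ℂ (QuditSpace F n))
    (j dz dx : ℕ) : Prop :=
  (∃ C₁ C₂ : Submodule F (Fin n → F), IsCSS C₁ C₂ Q j dz dx ∧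
    ∃ d₁ d₂ : ℕ, HasMinDist C₁ d₁ ∧ HasMinDist C₂ d₂ ∧ ({dz, dx} : Set ℕ) = {d₁, d₂}) ∧
  (j : ℤ) = (n : ℤ) - dx - dz + 2

/-!
# Pure CSS asymmetric quantum MDS codes

Adding the classical Singleton bounds of `C₁` and `C₂` gives the bound `j ≤ n - dx - dz + 2` for
pure codes, so in a pure CSS AQMDS code both `C₁` and `C₂` are MDS. Conversely, if `B ≤ A` are MDS
codes, the CSS code of `C₁ = B^⊥` and `C₂ = A` is pure: a nonzero `X`-error of small weight is not
in `C₂` and moves the code to a disjoint support, and a nonzero `Z`-error of small weight is not in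
`C₁` and averages to zero over the cosets of `C₁^⊥` (`isAQC_cssCode`). Hence the theorem is about the
existence of nested MDS codes of dimensions `k` and `k + j` in `F ^ n`
(`exists_isPureCSSAQMDS_iff`), a notion that is invariant under duality
(`HasNestedMDS.euclideanDual`).

For the necessity of the conditions, the MDS conjecture bounds the length of both codes. When
`n = q + 1` and `j = 1`, the two codes glue to an MDS code of length `q + 2` and dimension `k + 1`
(`exists_isMDSOfDim_option`), to which the conjecture applies again. Over `𝔽₂` the elementary bound
`n ≤ q + k - 1` for `k ≥ 2` (`IsMDSOfDim.card_index_le`) leaves only trivial codes, and nested codes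
of dimensions `1` and `n - 1` force `n` to be even.

For the sufficiency, the codes consist of values of polynomials.
* For `n ≤ q` they are Reed–Solomon codes.
* For `n = q + 1`, the multiples of a polynomial `h` of degree `j` without zeros lie in a doubly
  extended Reed–Solomon code (`hasNestedMDS_option`). Such an `h = X ^ j - X - b` exists whenever
  `j ≥ 2`, because `x ↦ x ^ j - x` is not injective, hence not surjective.
* For even `q` and `n = q + 2`, the code of the hyperoval consisting of a conic and its nucleus has
  dimension `3`. It contains a word without zeros, and so does its dual when `q ≥ 4`. It lies in
  the dual of an equivalent code, with infinity and the nucleus interchanged and with the coordinate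
  of `x` scaled by a polynomial of degree `q - 4` without zeros (`hasNestedMDS_hyperoval_three`).
-/

open Module Finset

/-! ### MDS codes on an arbitrary index set -/

section MDS

variable {F : Type*} [Field F] {ι κ : Type*}

/-- `C` is an MDS code of dimension `k`, expressed through information sets: a codeword that
vanishes on at least `k` coordinates is zero. Unlike `IsMDS`, this makes sense over every index type
and includes the zero code (`k = 0`). -/
def IsMDSOfDim (C : Submodule F (ι → F)) (k : ℕ) : Prop :=
  finrank F C = k ∧ ∀ v ∈ C, ∀ T : Finset ι, k ≤ #T → (∀ i ∈ T, v i = 0) → v = 0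

variable (F ι) in
/-- There are MDS codes of dimensions `k` and `l`, the first contained in the second. -/
def HasNestedMDS (k l : ℕ) : Prop :=
  ∃ B A : Submodule F (ι → F), B ≤ A ∧ IsMDSOfDim B k ∧ IsMDSOfDim A l

lemma isMDSOfDim_span_singleton [Nonempty ι] {u : ι → F} (hu : ∀ i, u i ≠ 0) :
    IsMDSOfDim (Submodule.span F {u}) 1 := by
  refine ⟨finrank_span_singleton fun h => hu (Classical.arbitrary ι) (by simp [h]), ?_⟩
  intro v hv T hT hz
  obtain ⟨c, rfl⟩ := Submodule.mem_span_singleton.1 hv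
  obtain ⟨i, hi⟩ := card_pos.1 hT
  have : c = 0 := by simpa [hu i] using hz i hi
  rw [this, zero_smul]

/-- The monomial map that reindexes the coordinates along `e` and scales them by `w`. -/
def monomialMap (e : κ → ι) (w : κ → F) : (ι → F) →ₗ[F] (κ → F) where
  toFun x i := w i * x (e i)
  map_add' x y := by ext; simp [mul_add]
  map_smul' c x := by ext; simp [mul_left_comm]

@[simp] lemma monomialMap_apply (e : κ → ι) (w : κ → F) (x : ι → F) (i : κ) :
    monomialMap e w x i = w i * x (e i) := rfl

lemma monomialMap_injective {e : κ → ι} (he : Function.Surjective e) {w : κ → F}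
    (hw : ∀ i, w i ≠ 0) : Function.Injective (monomialMap e w) := by
  rw [injective_iff_map_eq_zero]
  intro x hx
  ext i
  obtain ⟨t, rfl⟩ := he i
  simpa [hw t] using congrFun hx t

lemma IsMDSOfDim.map_monomialMap {C : Submodule F (ι → F)} {k : ℕ} (hC : IsMDSOfDim C k)
    (e : κ ≃ ι) {w : κ → F} (hw : ∀ i, w i ≠ 0) :
    IsMDSOfDim (C.map (monomialMap e w)) k := by
  refine ⟨by rw [← (C.equivMapOfInjective _ (monomialMap_injective e.surjective hw)).finrank_eq,
    hC.1], ?_⟩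
  rintro _ ⟨v, hv, rfl⟩ T hT hz
  rw [hC.2 v hv (T.map e.toEmbedding) (by simpa using hT), map_zero]
  intro t ht
  simpa [hw] using hz (e.symm t) (by simpa using ht)

lemma IsMDSOfDim.hasNestedMDS_self {C : Submodule F (ι → F)} {k : ℕ} (hC : IsMDSOfDim C k) :
    HasNestedMDS F ι k k := ⟨C, C, le_rfl, hC, hC⟩

variable [Fintype ι] [Fintype κ]

/-- The Euclidean dual of a code over an arbitrary index type, as an orthogonal complement for
the bilinear form `dotProduct`. -/
def euclideanDual (C : Submodule F (ι → F)) : Submodule F (ι → F) :=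
  LinearMap.BilinForm.orthogonal (dotProductBilin F F) C

lemma mem_euclideanDual {C : Submodule F (ι → F)} {u : ι → F} :
    u ∈ euclideanDual C ↔ ∀ v ∈ C, v ⬝ᵥ u = 0 := Iff.rfl

lemma isRefl_dotProductBilin : (dotProductBilin F F : LinearMap.BilinForm F (ι → F)).IsRefl :=
  fun x y h => by simpa [dotProduct_comm] using h

lemma nondegenerate_dotProductBilin :
    (dotProductBilin F F : LinearMap.BilinForm F (ι → F)).Nondegenerate := by
  classical
  rw [LinearMap.IsRefl.nondegenerate_iff_separatingLeft isRefl_dotProductBilin]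
  intro x hx
  exact dotProduct_eq_zero x hx

lemma finrank_euclideanDual (C : Submodule F (ι → F)) :
    finrank F (euclideanDual C) = Fintype.card ι - finrank F C := by
  rw [euclideanDual, LinearMap.BilinForm.finrank_orthogonal nondegenerate_dotProductBilin,
    finrank_fintype_fun_eq_card]

lemma euclideanDual_euclideanDual (C : Submodule F (ι → F)) :
    euclideanDual (euclideanDual C) = C :=
  LinearMap.BilinForm.orthogonal_orthogonal (B := dotProductBilin F F)
    nondegenerate_dotProductBilin isRefl_dotProductBilin C

lemma euclideanDual_anti {B A : Submodule F (ι → F)} (h : B ≤ A) :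
    euclideanDual A ≤ euclideanDual B :=
  fun _ hu v hv => hu v (h hv)

lemma dualCode_eq_euclideanDual {n : ℕ} (C : Submodule F (Fin n → F)) :
    dualCode C = euclideanDual C := by
  ext u
  exact forall₂_congr fun v _ => by rw [dotProduct_comm]; rfl

lemma finrank_le_card (C : Submodule F (ι → F)) : finrank F C ≤ Fintype.card ι := by
  simpa using C.finrank_le

lemma IsMDSOfDim.le_card {C : Submodule F (ι → F)} {k : ℕ} (hC : IsMDSOfDim C k) :
    k ≤ Fintype.card ι := hC.1 ▸ finrank_le_card C

/-- Every set of `k` coordinates of an MDS code of dimension `k` is an information set. -/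
lemma IsMDSOfDim.exists_eqOn {C : Submodule F (ι → F)} {k : ℕ} (hC : IsMDSOfDim C k)
    {S : Finset ι} (hS : #S = k) (g : ι → F) : ∃ c ∈ C, ∀ i ∈ S, c i = g i := by
  let r : C →ₗ[F] (S → F) := LinearMap.funLeft F F ((↑) : S → ι) ∘ₗ C.subtype
  have hr : ∀ (c : C) (i : S), r c i = c.1 i := fun _ _ => rfl
  have hinj : Function.Injective r := by
    rw [injective_iff_map_eq_zero]
    intro c hc
    refine Subtype.ext (hC.2 c c.2 S hS.ge fun i hi => ?_)
    rw [← hr c ⟨i, hi⟩, hc, Pi.zero_apply]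
  have hdim : finrank F C = finrank F (S → F) := by simp [hC.1, hS]
  obtain ⟨c, hc⟩ := (LinearMap.injective_iff_surjective_of_finrank_eq_finrank hdim).1 hinj
    (fun i => g i)
  exact ⟨c, c.2, fun i hi => by rw [← hr c ⟨i, hi⟩, hc]⟩

lemma IsMDSOfDim.euclideanDual {C : Submodule F (ι → F)} {k : ℕ} (hC : IsMDSOfDim C k) :
    IsMDSOfDim (euclideanDual C) (Fintype.card ι - k) := by
  classical
  refine ⟨by rw [finrank_euclideanDual, hC.1], fun u hu T hT hz => ?_⟩
  have hTc : #Tᶜ ≤ k := by rw [card_compl]; omega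
  -- enlarge the complement of `T`, which contains the support of `u`, to an information set
  obtain ⟨S, hTS, -, hS⟩ := exists_subsuperset_card_eq (subset_univ Tᶜ) hTc (by
    rw [card_univ]; exact hC.le_card)
  funext i
  rw [Pi.zero_apply]
  by_contra hi
  have hiS : i ∈ S := hTS (mem_compl.2 fun h => hi (hz i h))
  obtain ⟨c, hcC, hc⟩ := hC.exists_eqOn hS (Pi.single i 1)
  refine hi ?_
  rw [← mem_euclideanDual.1 hu c hcC, dotProduct, Finset.sum_eq_single i]
  · simp [hc i hiS]
  · intro t _ hti
    by_cases ht : t ∈ S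
    · simp [hc t ht, hti]
    · rw [hz t (by by_contra h; exact ht (hTS (mem_compl.2 h))), mul_zero]
  · simp

lemma HasNestedMDS.euclideanDual {k l : ℕ} (h : HasNestedMDS F ι k l) :
    HasNestedMDS F ι (Fintype.card ι - l) (Fintype.card ι - k) := by
  obtain ⟨B, A, hBA, hB, hA⟩ := h
  exact ⟨_, _, euclideanDual_anti hBA, hA.euclideanDual, hB.euclideanDual⟩

lemma HasNestedMDS.congr {k l : ℕ} (h : HasNestedMDS F ι k l)
    (hc : Fintype.card κ = Fintype.card ι) : HasNestedMDS F κ k l := by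
  obtain ⟨B, A, hBA, hB, hA⟩ := h
  let e := Fintype.equivOfCardEq hc
  exact ⟨_, _, Submodule.map_mono hBA, hB.map_monomialMap e (fun _ => one_ne_zero),
    hA.map_monomialMap e (fun _ => one_ne_zero)⟩

lemma isMDSOfDim_top : IsMDSOfDim (⊤ : Submodule F (ι → F)) (Fintype.card ι) := by
  refine ⟨by simp, fun v _ T hT hz => ?_⟩
  rw [(card_eq_iff_eq_univ T).1 (le_antisymm (card_le_univ T) hT)] at hz
  exact funext fun i => hz i (mem_univ i)

lemma isMDSOfDim_range {V : Type*} [AddCommGroup V] [Module F V] {k : ℕ} (hV : finrank F V = k)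
    (hk : k ≤ Fintype.card ι) (f : V →ₗ[F] (ι → F))
    (h : ∀ v, ∀ T : Finset ι, k ≤ #T → (∀ i ∈ T, f v i = 0) → v = 0) :
    IsMDSOfDim (LinearMap.range f) k := by
  refine ⟨?_, ?_⟩
  · rw [LinearMap.finrank_range_of_inj, hV]
    rw [injective_iff_map_eq_zero]
    exact fun v hv => h v univ (by simpa using hk) (by simp [hv])
  · rintro _ ⟨v, rfl⟩ T hT hz
    rw [h v T hT hz, map_zero]

/-- The Singleton bound: some nonzero codeword vanishes on any prescribed `dim C - 1`
coordinates. -/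
lemma exists_ne_zero_vanishing (C : Submodule F (ι → F)) (T : Finset ι)
    (hT : #T < finrank F C) : ∃ v ∈ C, v ≠ 0 ∧ ∀ i ∈ T, v i = 0 := by
  let r : C →ₗ[F] (T → F) := LinearMap.funLeft F F ((↑) : T → ι) ∘ₗ C.subtype
  have hr : ∀ (c : C) (i : T), r c i = c.1 i := fun _ _ => rfl
  obtain ⟨v, hv, hv0⟩ := (Submodule.ne_bot_iff _).1
    (r.ker_ne_bot_of_finrank_lt (by simpa using hT))
  refine ⟨v, v.2, by simpa using hv0, fun i hi => ?_⟩
  rw [← hr v ⟨i, hi⟩, LinearMap.mem_ker.1 hv, Pi.zero_apply]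

/-- An MDS code of dimension `k ≥ 2` has length at most `q + k - 1`. Two independent codewords
`u`, `v` that vanish on `k - 2` common coordinates give an injection of the remaining coordinates
into the projective line, sending `i` to the point `u i / v i`. -/
lemma IsMDSOfDim.card_index_le [Fintype F] {C : Submodule F (ι → F)} {k : ℕ}
    (hC : IsMDSOfDim C k) (hk : 2 ≤ k) : Fintype.card ι + 1 ≤ Fintype.card F + k := by
  classical
  obtain ⟨S, -, hS⟩ := exists_subset_card_eq (s := (univ : Finset ι)) (n := k) (by
    simpa using hC.le_card)
  obtain ⟨s, hs, t, ht, hst⟩ := one_lt_card.1 (by omega : 1 < #S)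
  set T := (S.erase s).erase t with hT
  have hTc : #T = k - 2 := by
    rw [hT, card_erase_of_mem (mem_erase.2 ⟨hst.symm, ht⟩), card_erase_of_mem hs, hS]; omega
  have hTs : s ∉ T := by simp [hT]
  have hTt : t ∉ T := by simp [hT]
  obtain ⟨u, huC, hu⟩ := hC.exists_eqOn hS (Pi.single s 1)
  obtain ⟨v, hvC, hv⟩ := hC.exists_eqOn hS (Pi.single t 1)
  have huT : ∀ i ∈ T, u i = 0 := fun i hi => by
    rw [hu i (mem_of_mem_erase (mem_of_mem_erase hi)), Pi.single_eq_of_ne]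
    rintro rfl; exact hTs hi
  have hvT : ∀ i ∈ T, v i = 0 := fun i hi => by
    rw [hv i (mem_of_mem_erase (mem_of_mem_erase hi)), Pi.single_eq_of_ne]
    rintro rfl; exact hTt hi
  have hus : u s = 1 := by simp [hu s hs]
  have hvs : v s = 0 := by simp [hv s hs, hst]
  have hvt : v t = 1 := by simp [hv t ht]
  have key : ∀ w ∈ C, (∀ i ∈ T, w i = 0) → ∀ a b, a ∉ T → b ∉ T → a ≠ b → w a = 0 → w b = 0 →
      w = 0 := by
    intro w hw hwT a b ha hb hab hwa hwb
    refine hC.2 w hw (insert a (insert b T)) ?_ ?_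
    · rw [card_insert_of_notMem (by simp [hab, ha]), card_insert_of_notMem hb]; omega
    · simpa [hwa, hwb] using hwT
  let f : {i // i ∉ T} → Option F := fun i => if v i = 0 then none else some (u i / v i)
  have hf : Function.Injective f := by
    rintro ⟨a, ha⟩ ⟨b, hb⟩ hab
    by_contra hne
    have hne' : a ≠ b := fun h => hne (Subtype.ext h)
    by_cases hva : v a = 0 <;> by_cases hvb : v b = 0 <;>
      simp only [f, hva, hvb, if_true, if_false, reduceCtorEq, Option.some.injEq] at hab
    · have := key v hvC hvT a b ha hb hne' hva hvb
      simp [this] at hvt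
    · have := key (u - (u a / v a) • v) (C.sub_mem huC (C.smul_mem _ hvC))
        (fun i hi => by simp [huT i hi, hvT i hi]) a b ha hb hne' (by simp [hva])
        (by rw [hab]; simp [hvb])
      have := congrFun this s
      simp [hus, hvs] at this
  have := Fintype.card_le_of_injective f hf
  rw [Fintype.card_option, Fintype.card_subtype_compl (fun i => i ∈ T), Fintype.card_coe] at this
  omega

/-- Nested MDS codes whose dimensions differ by one come from a longer MDS code: adjoin a new
coordinate which is `0` on the smaller code and `1` on a word that generates the larger
one over it. -/
lemma exists_isMDSOfDim_option {B A : Submodule F (ι → F)} {k : ℕ} (hBA : B ≤ A)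
    (hB : IsMDSOfDim B k) (hA : IsMDSOfDim A (k + 1)) (hk : k + 1 ≤ Fintype.card ι) :
    ∃ C : Submodule F (Option ι → F), IsMDSOfDim C (k + 1) := by
  classical
  obtain ⟨v, hvA, hvB⟩ := SetLike.exists_of_lt (lt_of_le_of_ne hBA (by
    rintro rfl
    have := hB.1.symm.trans hA.1
    omega))
  let f : B × F →ₗ[F] (Option ι → F) :=
    { toFun := fun x o => o.elim x.2 fun i => x.1.1 i + x.2 * v i
      map_add' := fun x y => by
        ext o
        cases o
        · rfl
        · simp; ring
      map_smul' := fun c x => by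
        ext o
        cases o
        · rfl
        · simp; ring }
  have hfn : ∀ x, f x none = x.2 := fun _ => rfl
  have hfs : ∀ x i, f x (some i) = (x.1.1 + x.2 • v) i := fun _ _ => rfl
  refine ⟨LinearMap.range f, isMDSOfDim_range (by simp [hB.1]) (by simp; omega) f ?_⟩
  intro x T hT hz
  have hsplit : #T ≤ #T.eraseNone + 1 := by
    rw [card_eraseNone_eq_card_erase]; exact tsub_le_iff_right.1 pred_card_le_card_erase
  have hz' : ∀ i ∈ T.eraseNone, (x.1.1 + x.2 • v) i = 0 := fun i hi => by
    rw [← hfs]; exact hz _ (mem_eraseNone.1 hi)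
  have main : x.2 = 0 → x.1.1 = 0 := fun h2 => by
    refine hB.2 _ x.1.2 T.eraseNone (by omega) ?_
    simpa [h2] using hz'
  suffices h2 : x.2 = 0 from Prod.ext (Subtype.ext (main h2)) h2
  by_cases hn : none ∈ T
  · rw [← hfn]; exact hz _ hn
  · have h0 := hA.2 _ (A.add_mem (hBA x.1.2) (A.smul_mem x.2 hvA)) T.eraseNone (by
      rw [card_eraseNone_eq_card_erase, erase_eq_of_notMem hn]; exact hT) hz'
    by_contra h2
    refine hvB ?_
    have : x.2 • v = -x.1.1 := by rw [eq_neg_iff_add_eq_zero, add_comm]; exact h0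
    rw [← inv_smul_smul₀ h2 v, this]
    exact B.smul_mem _ (B.neg_mem x.1.2)

end MDS

lemma exists_ne_ne {α : Type*} [Fintype α] (hq : 3 ≤ Fintype.card α) (a b : α) :
    ∃ t, t ≠ a ∧ t ≠ b := by
  classical
  obtain ⟨t, -, ht⟩ := exists_mem_notMem_of_card_lt_card (s := {a, b}) (t := (univ : Finset α))
    (card_le_two.trans_lt (by simpa using Nat.lt_of_succ_le hq))
  simp only [mem_insert, mem_singleton, not_or] at ht
  exact ⟨t, ht⟩

/-! ### Nested MDS codes of dimensions 1, n - 1 and n -/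

section Constructions

variable {F : Type*} [Field F] {ι : Type*} [Fintype ι]

lemma IsMDSOfDim.hasNestedMDS_top {C : Submodule F (ι → F)} {k : ℕ} (hC : IsMDSOfDim C k) :
    HasNestedMDS F ι k (Fintype.card ι) := ⟨C, ⊤, le_top, hC, isMDSOfDim_top⟩

/-- A word without zeros whose entries sum to `0` gives an MDS code of codimension one that
contains the repetition code. -/
lemma hasNestedMDS_one_pred [Nonempty ι] {u : ι → F} (hu : ∀ i, u i ≠ 0) (hs : ∑ i, u i = 0) :
    HasNestedMDS F ι 1 (Fintype.card ι - 1) := by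
  refine ⟨Submodule.span F {1}, euclideanDual (Submodule.span F {u}), ?_,
    isMDSOfDim_span_singleton fun _ => one_ne_zero, (isMDSOfDim_span_singleton hu).euclideanDual⟩
  rw [Submodule.span_singleton_le_iff_mem, mem_euclideanDual]
  intro v hv
  obtain ⟨c, rfl⟩ := Submodule.mem_span_singleton.1 hv
  have : u ⬝ᵥ 1 = 0 := by rw [dotProduct_one, hs]
  rw [smul_dotProduct, this, smul_zero]

variable [Fintype F] in
/-- Over a field with at least three elements, every element is a sum of `n + 2` nonzero
elements. -/
lemma exists_ne_zero_sum_eq (hq : 3 ≤ Fintype.card F) (n : ℕ) (s : F) :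
    ∃ u : Fin (n + 2) → F, (∀ i, u i ≠ 0) ∧ ∑ i, u i = s := by
  induction n generalizing s with
  | zero =>
    obtain ⟨t, ht0, hts⟩ := exists_ne_ne hq 0 s
    refine ⟨![t, s - t], fun i => ?_, by simp⟩
    fin_cases i
    · exact ht0
    · exact sub_ne_zero.2 hts.symm
  | succ n ih =>
    obtain ⟨u, hu, hs⟩ := ih (s - 1)
    refine ⟨Fin.cons 1 u, Fin.cases one_ne_zero hu, ?_⟩
    rw [Fin.sum_univ_succ]
    simp [hs]

end Constructions

/-! ### Reed–Solomon codes -/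

section ReedSolomon

variable {F : Type*} [Field F]

open Polynomial in
/-- The values of `h * f` at all points of `F`, for polynomials `f` of degree less than `k`,
together with the coefficient of `X ^ (k - 1)` in `f`, which plays the role of the value at
infinity. For `h = 1` these are the words of the doubly extended Reed–Solomon code. -/
noncomputable def projectiveEval (h : F[X]) (k : ℕ) : degreeLT F k →ₗ[F] (Option F → F) :=
  LinearMap.pi (fun o => o.elim (lcoeff F (k - 1)) fun x => h.eval x • leval x) ∘ₗ
    (degreeLT F k).subtype

open Polynomial in
@[simp] lemma projectiveEval_none (h : F[X]) (k : ℕ) (f : degreeLT F k) :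
    projectiveEval h k f none = f.1.coeff (k - 1) := rfl

open Polynomial in
@[simp] lemma projectiveEval_some (h : F[X]) (k : ℕ) (f : degreeLT F k) (x : F) :
    projectiveEval h k f (some x) = h.eval x * f.1.eval x := rfl

variable [Fintype F]

open Polynomial in
/-- Reed–Solomon codes at distinct points are nested and MDS. -/
lemma hasNestedMDS_of_card_le {ι : Type*} [Fintype ι] (hι : Fintype.card ι ≤ Fintype.card F)
    {k l : ℕ} (hkl : k ≤ l) (hl : l ≤ Fintype.card ι) : HasNestedMDS F ι k l := by
  obtain ⟨α⟩ := Function.Embedding.nonempty_of_card_le hι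
  let ev : F[X] →ₗ[F] (ι → F) := LinearMap.pi fun i => leval (α i)
  have hev : ∀ f i, ev f i = f.eval (α i) := fun _ _ => rfl
  have hmds : ∀ m ≤ Fintype.card ι,
      IsMDSOfDim (LinearMap.range (ev ∘ₗ (degreeLT F m).subtype)) m := by
    intro m hm
    refine isMDSOfDim_range (by simp [(degreeLTEquiv F m).finrank_eq]) hm _ ?_
    rintro ⟨f, hf⟩ T hT hz
    refine Subtype.ext (eq_zero_of_degree_lt_of_eval_finset_eq_zero (T.map α)
      ((mem_degreeLT.1 hf).trans_le (by simpa using hT)) ?_)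
    simpa [hev] using hz
  refine ⟨_, _, ?_, hmds k (hkl.trans hl), hmds l hl⟩
  simpa only [LinearMap.range_comp, Submodule.range_subtype] using
    Submodule.map_mono (degreeLT_mono hkl)

open Polynomial in
lemma isMDSOfDim_projectiveEval {h : F[X]} (hh : ∀ x, h.eval x ≠ 0) {k : ℕ}
    (hk : k ≤ Fintype.card F + 1) : IsMDSOfDim (LinearMap.range (projectiveEval h k)) k := by
  classical
  refine isMDSOfDim_range (by simp [(degreeLTEquiv F k).finrank_eq]) (by simpa using hk) _ ?_
  rintro ⟨f, hf⟩ T hT hz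
  have hdeg := (degree_lt_iff_coeff_zero f k).1 (mem_degreeLT.1 hf)
  refine Subtype.ext (eq_zero_of_degree_lt_of_eval_finset_eq_zero T.eraseNone ?_ ?_)
  · rw [degree_lt_iff_coeff_zero]
    intro m hm
    rw [card_eraseNone_eq_card_erase] at hm
    rcases le_or_gt k m with hkm | hkm
    · exact hdeg m hkm
    · -- only the coefficient of `X ^ (k - 1)` is left, and then infinity belongs to `T`
      have hn : none ∈ T := by
        by_contra hn
        rw [erase_eq_of_notMem hn] at hm
        omega
      rw [card_erase_of_mem hn] at hm
      obtain rfl : m = k - 1 := by omega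
      exact hz none hn
  · intro x hx
    simpa [hh x] using hz (some x) (mem_eraseNone.1 hx)

/-- `X ^ j - X` takes the value `0` at both `0` and `1`, so it is not a permutation of `F` and
misses some value. -/
lemma exists_pow_sub_sub_ne_zero {j : ℕ} (hj : j ≠ 0) : ∃ b : F, ∀ x : F, x ^ j - x - b ≠ 0 := by
  by_contra! hcon
  have hs : Function.Surjective fun x : F => x ^ j - x := fun b => by
    obtain ⟨x, hx⟩ := hcon b
    exact ⟨x, sub_eq_zero.1 hx⟩
  have := Finite.injective_iff_surjective.2 hs (a₁ := 0) (a₂ := 1) (by simp [hj])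
  exact zero_ne_one this

open Polynomial in
/-- If `h` is a polynomial of degree `j` without zeros, the multiples `h * f` with `deg f < k`
form an MDS code of dimension `k` inside the doubly extended Reed–Solomon code of dimension
`k + j`. -/
lemma hasNestedMDS_option {k j : ℕ} (hk : 0 < k) (hj : j = 0 ∨ 2 ≤ j)
    (hkj : k + j ≤ Fintype.card F + 1) : HasNestedMDS F (Option F) k (k + j) := by
  obtain ⟨h, hmon, hdeg, hh⟩ : ∃ h : F[X], h.Monic ∧ h.natDegree = j ∧ ∀ x, h.eval x ≠ 0 := by
    rcases hj with rfl | hj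
    · exact ⟨1, monic_one, by simp, by simp⟩
    · obtain ⟨b, hb⟩ := exists_pow_sub_sub_ne_zero (F := F) (j := j) (by omega)
      have hlt : (X + C b).degree < (j : WithBot ℕ) := by
        rw [degree_X_add_C]; exact_mod_cast hj
      refine ⟨X ^ j - (X + C b), monic_X_pow_sub hlt, ?_, fun x => ?_⟩
      · rw [natDegree_sub_eq_left_of_natDegree_lt, natDegree_X_pow]
        rw [natDegree_X_add_C, natDegree_X_pow]; omega
      · simpa [sub_sub] using hb x
  refine ⟨_, _, ?_, isMDSOfDim_projectiveEval hh (by omega),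
    isMDSOfDim_projectiveEval (h := 1) (by simp) hkj⟩
  rintro _ ⟨⟨f, hf⟩, rfl⟩
  have hf' : f.natDegree ≤ k - 1 := by
    rcases eq_or_ne f 0 with rfl | hf0
    · simp
    · have := (natDegree_lt_iff_degree_lt hf0).2 (mem_degreeLT.1 hf)
      omega
  refine ⟨⟨h * f, ?_⟩, ?_⟩
  · rw [mem_degreeLT]
    refine degree_le_natDegree.trans_lt ?_
    have := natDegree_mul_le (p := h) (q := f)
    exact_mod_cast (by omega : (h * f).natDegree < k + j)
  · ext o
    cases o with
    | none =>
      have := coeff_mul_add_eq_of_natDegree_le hdeg.le hf'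
      simp only [projectiveEval_none, show k + j - 1 = j + (k - 1) by omega, this]
      rw [← hdeg, hmon.coeff_natDegree, one_mul]
    | some x => simp

end ReedSolomon

/-! ### Hyperovals in characteristic 2 -/

section Hyperoval

variable {F : Type*} [Field F]

lemma eq_zero_of_sq_sub_sq (h2 : (2 : F) = 0) {c x y : F} (hxy : x ≠ y)
    (h : c * x ^ 2 = c * y ^ 2) : c = 0 := by
  have : c * (x - y) ^ 2 = 0 := by linear_combination h + (c * y ^ 2 - c * x * y) * h2
  simpa [sub_eq_zero, hxy] using this

variable (F) in
/-- The words of the hyperoval code: the values of `a 0 + a 1 * x + a 2 * x ^ 2` on `F`, the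
coefficient `a 2` (at the point `none` of the conic) and the coefficient `a 1` (at the nucleus
`some none`). -/
def hyperovalEval : (Fin 3 → F) →ₗ[F] (Option (Option F) → F) where
  toFun a o := o.elim (a 2) fun o => o.elim (a 1) fun x => a 0 + a 1 * x + a 2 * x ^ 2
  map_add' a b := by
    ext o
    rcases o with _ | _ | x
    · rfl
    · rfl
    · simp; ring
  map_smul' c a := by
    ext o
    rcases o with _ | _ | x
    · rfl
    · rfl
    · simp; ring

@[simp] lemma hyperovalEval_none (a : Fin 3 → F) : hyperovalEval F a none = a 2 := rfl

@[simp] lemma hyperovalEval_some_none (a : Fin 3 → F) :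
    hyperovalEval F a (some none) = a 1 := rfl

@[simp] lemma hyperovalEval_some_some (a : Fin 3 → F) (x : F) :
    hyperovalEval F a (some (some x)) = a 0 + a 1 * x + a 2 * x ^ 2 := rfl

variable [Fintype F]

lemma isMDSOfDim_hyperoval (h2 : (2 : F) = 0) :
    IsMDSOfDim (LinearMap.range (hyperovalEval F)) 3 := by
  classical
  refine isMDSOfDim_range (by simp) ?_ _ ?_
  · have := Fintype.one_lt_card (α := F)
    simp only [Fintype.card_option]
    omega
  intro a T hT hz
  suffices h : a 0 = 0 ∧ a 1 = 0 ∧ a 2 = 0 by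
    ext i
    fin_cases i
    exacts [h.1, h.2.1, h.2.2]
  set S := T.eraseNone.eraseNone with hS
  have hSz : ∀ x ∈ S, a 0 + a 1 * x + a 2 * x ^ 2 = 0 := fun x hx =>
    hz (some (some x)) (by simpa [hS] using hx)
  have hcard : #S = #((T.erase none).eraseNone.erase none) := by
    rw [hS, card_eraseNone_eq_card_erase]
    congr 2
    ext
    simp
  have hcard' : #(T.erase none).eraseNone = #(T.erase none) := by
    rw [card_eraseNone_eq_card_erase, erase_eq_of_notMem (by simp)]
  have hmem : none ∈ (T.erase none).eraseNone ↔ some none ∈ T := by simp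
  by_cases hi : none ∈ T <;> by_cases hn : some none ∈ T
  · have ha2 : a 2 = 0 := hz _ hi
    have ha1 : a 1 = 0 := hz _ hn
    rw [card_erase_of_mem (hmem.2 hn), hcard', card_erase_of_mem hi] at hcard
    obtain ⟨x, hx⟩ := card_pos.1 (by omega : 0 < #S)
    exact ⟨by simpa [ha1, ha2] using hSz x hx, ha1, ha2⟩
  · have ha2 : a 2 = 0 := hz _ hi
    rw [erase_eq_of_notMem (mt hmem.1 hn), hcard', card_erase_of_mem hi] at hcard
    obtain ⟨x, hx, y, hy, hxy⟩ := one_lt_card.1 (by omega : 1 < #S)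
    have h1 := hSz x hx
    have h3 := hSz y hy
    have ha1 : a 1 = 0 := by
      refine (mul_eq_zero.1 ?_).resolve_right (sub_ne_zero.2 hxy)
      linear_combination h1 - h3 - (x ^ 2 - y ^ 2) * ha2
    exact ⟨by simpa [ha1, ha2] using h1, ha1, ha2⟩
  · have ha1 : a 1 = 0 := hz _ hn
    rw [card_erase_of_mem (hmem.2 hn), hcard', erase_eq_of_notMem hi] at hcard
    obtain ⟨x, hx, y, hy, hxy⟩ := one_lt_card.1 (by omega : 1 < #S)
    have h1 := hSz x hx
    have h3 := hSz y hy
    have ha2 : a 2 = 0 := eq_zero_of_sq_sub_sq h2 hxy (by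
      linear_combination h1 - h3 - (x - y) * ha1)
    exact ⟨by simpa [ha1, ha2] using h1, ha1, ha2⟩
  · rw [erase_eq_of_notMem (mt hmem.1 hn), hcard', erase_eq_of_notMem hi] at hcard
    obtain ⟨x, hx, y, hy, z, hz, hxy, hxz, hyz⟩ := two_lt_card.1 (by omega : 2 < #S)
    have h1 := hSz x hx
    have h3 := hSz y hy
    have h4 := hSz z hz
    have h5 : a 1 + a 2 * (x + y) = 0 := by
      refine (mul_eq_zero.1 ?_).resolve_right (sub_ne_zero.2 hxy)
      linear_combination h1 - h3
    have h6 : a 1 + a 2 * (x + z) = 0 := by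
      refine (mul_eq_zero.1 ?_).resolve_right (sub_ne_zero.2 hxz)
      linear_combination h1 - h4
    have ha2 : a 2 = 0 := by
      refine (mul_eq_zero.1 ?_).resolve_right (sub_ne_zero.2 hyz)
      linear_combination h5 - h6
    have ha1 : a 1 = 0 := by simpa [ha2] using h5
    exact ⟨by simpa [ha1, ha2] using h1, ha1, ha2⟩

/-- A quadratic polynomial without zeros and with nonzero coefficients is a word of the hyperoval
code without zeros. -/
lemma hasNestedMDS_hyperoval_one_three (h2 : (2 : F) = 0) :
    HasNestedMDS F (Option (Option F)) 1 3 := by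
  obtain ⟨b, hb⟩ := exists_pow_sub_sub_ne_zero (F := F) two_ne_zero
  refine ⟨Submodule.span F {hyperovalEval F ![-b, -1, 1]}, _, ?_,
    isMDSOfDim_span_singleton ?_, isMDSOfDim_hyperoval h2⟩
  · rw [Submodule.span_singleton_le_iff_mem]
    exact LinearMap.mem_range_self _ _
  · rintro (_ | _ | x)
    · simp
    · simp
    · intro h
      refine hb x ?_
      rw [← h]
      simp
      ring

/-- The dual hyperoval code contains a word without zeros. The power sums of `F` of exponents at
most `2` vanish, so the all-one word on `F` is orthogonal to the values of quadratic polynomials;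
adding `t` at `0`, `1`, at the point at infinity and at the nucleus changes the inner products by
even multiples of `t`. -/
lemma hasNestedMDS_hyperoval_one (h2 : (2 : F) = 0) (hq : 4 ≤ Fintype.card F) :
    HasNestedMDS F (Option (Option F)) 1 (Fintype.card F - 1) := by
  classical
  obtain ⟨t, ht0, ht1⟩ := exists_ne_ne (α := F) (by omega) 0 (-1)
  have h1t : 1 + t ≠ 0 := fun h => ht1 (by linear_combination h)
  let u : Option (Option F) → F := fun o => o.elim t fun o => o.elim t fun x =>
    1 + (if x = 0 then t else 0) + (if x = 1 then t else 0)
  have hu : ∀ i, u i ≠ 0 := by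
    rintro (_ | _ | x)
    · exact ht0
    · exact ht0
    · by_cases hx0 : x = 0
      · simpa [u, hx0] using h1t
      · by_cases hx1 : x = 1
        · simpa [u, hx1] using h1t
        · simp [u, hx0, hx1]
  have hA := (isMDSOfDim_hyperoval h2).euclideanDual
  rw [Fintype.card_option, Fintype.card_option,
    show Fintype.card F + 1 + 1 - 3 = Fintype.card F - 1 by omega] at hA
  refine ⟨Submodule.span F {u}, _, ?_, isMDSOfDim_span_singleton hu, hA⟩
  rw [Submodule.span_singleton_le_iff_mem, mem_euclideanDual]
  rintro _ ⟨a, rfl⟩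
  have hpow : ∀ i < 3, ∑ x : F, x ^ i = 0 := fun i hi =>
    FiniteField.sum_pow_lt_card_sub_one F i (by omega)
  have hsum : ∑ x : F, (a 0 + a 1 * x + a 2 * x ^ 2) = 0 := by
    have h1 := hpow 1 (by norm_num)
    simp only [pow_one] at h1
    rw [sum_add_distrib, sum_add_distrib, ← mul_sum, ← mul_sum, h1, hpow 2 (by norm_num)]
    simp
  simp only [dotProduct, Fintype.sum_option, hyperovalEval_none, hyperovalEval_some_none,
    hyperovalEval_some_some, u, Option.elim_none, Option.elim_some, mul_add, mul_one, mul_ite,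
    mul_zero, sum_add_distrib, sum_ite_eq', mem_univ, if_true] at hsum ⊢
  linear_combination hsum + (t * a 0 + t * a 1 + t * a 2) * h2

/-- The hyperoval code is contained in the dual of a code monomially equivalent to it. The second
copy interchanges infinity and the nucleus and scales the coordinate `x` by
`w x = x ^ (q - 4) - x - b`, which has no zeros on `F` for a suitable `b`. Among the moments
`∑ w x * x ^ i`, `i ≤ 4`, only the one with `i = 3` is nonzero; it is cancelled by the contributions of the two interchanged points. -/
lemma hasNestedMDS_hyperoval_three (h2 : (2 : F) = 0) (hq : 8 ≤ Fintype.card F) :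
    HasNestedMDS F (Option (Option F)) 3 (Fintype.card F - 1) := by
  classical
  set q := Fintype.card F with hqdef
  obtain ⟨b, hb⟩ := exists_pow_sub_sub_ne_zero (F := F) (j := q - 4) (by omega)
  let f : F → F := fun x => x ^ (q - 4) - x - b
  have hpow : ∀ i < q - 1, ∑ x : F, x ^ i = 0 := FiniteField.sum_pow_lt_card_sub_one F
  have hM : ∀ i, i ≤ 4 → ∑ x : F, f x * x ^ i = ∑ x : F, x ^ (q - 4 + i) := by
    intro i hi
    have : ∀ x : F, f x * x ^ i = x ^ (q - 4 + i) - x ^ (i + 1) - b * x ^ i := fun x => by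
      simp only [f]; ring
    simp_rw [this]
    rw [sum_sub_distrib, sum_sub_distrib, ← mul_sum, hpow i (by omega), hpow (i + 1) (by omega)]
    ring
  have hM' : ∀ i ≤ 2, ∑ x : F, f x * x ^ i = 0 := fun i hi => by
    rw [hM i (by omega), hpow _ (by omega)]
  have hM0 := hM' 0 (by omega)
  have hM1 := hM' 1 (by omega)
  have hM2 := hM' 2 (by omega)
  have hM3 : ∑ x : F, f x * x ^ 3 = -1 := by
    rw [hM 3 (by omega), show q - 4 + 3 = q - 1 by omega]
    have : ∀ x : F, x ^ (q - 1) = 1 - if x = 0 then 1 else 0 := fun x => by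
      split_ifs with hx
      · rw [hx, zero_pow (by omega), sub_self]
      · rw [FiniteField.pow_card_sub_one_eq_one x hx, sub_zero]
    simp_rw [this]
    simp
  have hM4 : ∑ x : F, f x * x ^ 4 = 0 := by
    rw [hM 4 (by omega), show q - 4 + 4 = q by omega]
    simp_rw [hqdef, FiniteField.pow_card]
    simpa using hpow 1 (by omega)
  let w : Option (Option F) → F := fun o => o.elim 1 fun o => o.elim 1 f
  have hw : ∀ i, w i ≠ 0 := by
    rintro (_ | _ | x)
    exacts [one_ne_zero, one_ne_zero, hb x]
  have hC := isMDSOfDim_hyperoval h2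
  have hA := (hC.map_monomialMap (Equiv.swap none (some none)) hw).euclideanDual
  rw [Fintype.card_option, Fintype.card_option,
    show Fintype.card F + 1 + 1 - 3 = q - 1 by omega] at hA
  refine ⟨_, _, ?_, hC, hA⟩
  rintro _ ⟨a, rfl⟩
  rw [mem_euclideanDual]
  rintro _ ⟨_, ⟨c, rfl⟩, rfl⟩
  have hswap : ∀ x : F, Equiv.swap none (some none) (some (some x)) = some (some x) := fun x =>
    Equiv.swap_apply_of_ne_of_ne (by simp) (by simp)
  have hsum : ∑ x : F, f x * (c 0 + c 1 * x + c 2 * x ^ 2) * (a 0 + a 1 * x + a 2 * x ^ 2) =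
      -(c 1 * a 2 + c 2 * a 1) := by
    calc _ = c 0 * a 0 * ∑ x : F, f x * x ^ 0 + (c 0 * a 1 + c 1 * a 0) * ∑ x : F, f x * x ^ 1 +
          (c 0 * a 2 + c 1 * a 1 + c 2 * a 0) * ∑ x : F, f x * x ^ 2 +
          (c 1 * a 2 + c 2 * a 1) * ∑ x : F, f x * x ^ 3 +
          c 2 * a 2 * ∑ x : F, f x * x ^ 4 := by
          simp_rw [mul_sum, ← sum_add_distrib]
          exact sum_congr rfl fun x _ => by ring
      _ = _ := by rw [hM0, hM1, hM2, hM3, hM4]; ring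
  simp only [dotProduct, Fintype.sum_option, monomialMap_apply, Equiv.swap_apply_left,
    Equiv.swap_apply_right, hswap, hyperovalEval_none, hyperovalEval_some_none,
    hyperovalEval_some_some, w, Option.elim_none, Option.elim_some, hsum]
  ring

open Polynomial in
/-- In characteristic 2 squaring is injective, so the polynomials `a + c * X ^ 2` form a
two-dimensional MDS code inside the doubly extended Reed–Solomon code of dimension three. -/
lemma hasNestedMDS_option_two_three (h2 : (2 : F) = 0) : HasNestedMDS F (Option F) 2 3 := by
  classical
  have hq := Fintype.one_lt_card (α := F)
  let g : F × F →ₗ[F] (Option F → F) :=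
    { toFun := fun p o => o.elim p.2 fun x => p.1 + p.2 * x ^ 2
      map_add' := fun p r => by
        ext o
        cases o
        · rfl
        · simp; ring
      map_smul' := fun c p => by
        ext o
        cases o
        · rfl
        · simp; ring }
  have hgn : ∀ p, g p none = p.2 := fun _ => rfl
  have hgs : ∀ p x, g p (some x) = p.1 + p.2 * x ^ 2 := fun _ _ => rfl
  refine ⟨LinearMap.range g, _, ?_, isMDSOfDim_range (by simp) (by simp; omega) g ?_,
    isMDSOfDim_projectiveEval (h := 1) (by simp) (by omega)⟩
  · rintro _ ⟨⟨a, c⟩, rfl⟩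
    refine ⟨⟨C a + C c * X ^ 2, mem_degreeLT.2 ?_⟩, ?_⟩
    · refine (degree_le_iff_coeff_zero _ 2 |>.2 fun m hm => ?_).trans_lt (by norm_num)
      have : 2 < m := by exact_mod_cast hm
      simp [coeff_C, coeff_X_pow, show m ≠ 0 by omega, show m ≠ 2 by omega]
    · ext o
      cases o
      · simp [hgn]
      · simp [hgs]
  · rintro ⟨a, c⟩ T hT hz
    have hz' : ∀ x ∈ T.eraseNone, a + c * x ^ 2 = 0 := fun x hx =>
      hz (some x) (mem_eraseNone.1 hx)
    have hc : c = 0 ∧ T.eraseNone.Nonempty := by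
      by_cases hn : none ∈ T
      · refine ⟨hz none hn, card_pos.1 ?_⟩
        rw [card_eraseNone_eq_card_erase, card_erase_of_mem hn]
        omega
      · rw [← erase_eq_of_notMem hn, ← card_eraseNone_eq_card_erase] at hT
        obtain ⟨x, hx, y, hy, hxy⟩ := one_lt_card.1 hT
        refine ⟨eq_zero_of_sq_sub_sq h2 hxy ?_, x, hx⟩
        linear_combination hz' x hx - hz' y hy
    obtain ⟨rfl, x, hx⟩ := hc
    have : a = 0 := by simpa using hz' x hx
    rw [this]
    rfl

end Hyperoval

/-! ### Minimum distances of MDS codes -/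

section MinDist

variable {F : Type*} [Field F] {n : ℕ}

lemma finrank_dualCode (C : Submodule F (Fin n → F)) :
    finrank F (dualCode C) = n - finrank F C := by
  rw [dualCode_eq_euclideanDual, finrank_euclideanDual, Fintype.card_fin]

lemma dualCode_dualCode (C : Submodule F (Fin n → F)) : dualCode (dualCode C) = C := by
  rw [dualCode_eq_euclideanDual, dualCode_eq_euclideanDual, euclideanDual_euclideanDual]

lemma hammingNorm_add_card_zeros [DecidableEq F] (v : Fin n → F) :
    hammingNorm v + #{i | v i = 0} = n := by
  have := card_filter_add_card_filter_not (s := (univ : Finset (Fin n))) (fun i => v i = 0)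
  rw [card_univ, Fintype.card_fin] at this
  have hw : hammingNorm v = #{i | ¬v i = 0} := by unfold hammingNorm; congr
  omega

lemma HasMinDist.finrank_pos {C : Submodule F (Fin n → F)} {d : ℕ} (h : HasMinDist C d) :
    0 < finrank F C := by
  obtain ⟨v, ⟨hv, hv0⟩, -⟩ := h.1
  exact finrank_pos_iff_exists_ne_zero.2 ⟨⟨v, hv⟩, fun h0 => hv0 (congrArg Subtype.val h0)⟩

lemma exists_hammingNorm_le [DecidableEq F] {C : Submodule F (Fin n → F)} (hC : 0 < finrank F C) :
    ∃ v ∈ C, v ≠ 0 ∧ hammingNorm v + finrank F C ≤ n + 1 := by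
  have hle := finrank_le_card C
  rw [Fintype.card_fin] at hle
  obtain ⟨T, -, hT⟩ := exists_subset_card_eq (s := (univ : Finset (Fin n)))
    (n := finrank F C - 1) (by rw [card_univ, Fintype.card_fin]; omega)
  obtain ⟨v, hv, hv0, hz⟩ := exists_ne_zero_vanishing C T (by omega)
  refine ⟨v, hv, hv0, ?_⟩
  have h1 := hammingNorm_add_card_zeros v
  have h2 : #T ≤ #{i | v i = 0} := card_le_card fun i hi => by simpa using hz i hi
  omega

lemma HasMinDist.add_finrank_le {C : Submodule F (Fin n → F)} {d : ℕ} (h : HasMinDist C d) :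
    d + finrank F C ≤ n + 1 := by
  classical
  obtain ⟨v, hv, hv0, hle⟩ := exists_hammingNorm_le h.finrank_pos
  have := h.2 ⟨v, ⟨hv, hv0⟩, rfl⟩
  convert le_trans (Nat.add_le_add_right this _) ?_
  convert hle

lemma HasMinDist.isMDSOfDim {C : Submodule F (Fin n → F)} {d k : ℕ} (h : HasMinDist C d)
    (hk : finrank F C = k) (hd : d + k = n + 1) : IsMDSOfDim C k := by
  classical
  refine ⟨hk, fun v hv T hT hz => ?_⟩
  by_contra hv0
  have h0 : d ≤ hammingNorm v := by convert h.2 ⟨v, ⟨hv, hv0⟩, rfl⟩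
  have h1 := hammingNorm_add_card_zeros v
  have h2 : #T ≤ #{i | v i = 0} := card_le_card fun i hi => by simpa using hz i hi
  omega

lemma IsMDSOfDim.lt_hammingNorm_add [DecidableEq F] {C : Submodule F (Fin n → F)} {k : ℕ}
    (hC : IsMDSOfDim C k) {v : Fin n → F} (hv : v ∈ C) (hv0 : v ≠ 0) : n < hammingNorm v + k := by
  by_contra hcon
  have h1 := hammingNorm_add_card_zeros v
  refine hv0 (hC.2 v hv {i | v i = 0} (by omega) fun i hi => by simpa using hi)

lemma IsMDSOfDim.hasMinDist {C : Submodule F (Fin n → F)} {k : ℕ} (hC : IsMDSOfDim C k)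
    (hk : 0 < k) : HasMinDist C (n + 1 - k) := by
  classical
  have hkn := hC.le_card
  rw [Fintype.card_fin] at hkn
  refine ⟨?_, ?_⟩
  · obtain ⟨v, hv, hv0, hle⟩ := exists_hammingNorm_le (hC.1.symm ▸ hk)
    refine ⟨v, ⟨hv, hv0⟩, ?_⟩
    have h1 := hC.lt_hammingNorm_add hv hv0
    have h2 : hammingNorm v = n + 1 - k := by rw [hC.1] at hle; omega
    convert h2
  · rintro _ ⟨v, ⟨hv, hv0⟩, rfl⟩
    have h1 := hC.lt_hammingNorm_add hv hv0
    have h2 : n + 1 - k ≤ hammingNorm v := by omega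
    convert h2

lemma hasCosetWeight_of_isMDSOfDim {B A : Submodule F (Fin n → F)} {k l : ℕ} (hBA : B ≤ A)
    (hB : IsMDSOfDim B k) (hA : IsMDSOfDim A l) (hl : 0 < l) :
    HasCosetWeight A B (n + 1 - l) := by
  classical
  by_cases hAB : A = B
  · exact .inr ⟨hAB, hA.hasMinDist hl⟩
  have hkl : k < l := by
    rw [← hB.1, ← hA.1]
    exact Submodule.finrank_lt_finrank_of_lt (lt_of_le_of_ne hBA (Ne.symm hAB))
  have hln := hA.le_card
  rw [Fintype.card_fin] at hln
  obtain ⟨⟨v, ⟨hv, hv0⟩, hvw⟩, hle⟩ := hA.hasMinDist hl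
  refine .inl ⟨hAB, ⟨v, ⟨hv, fun hvB => ?_⟩, hvw⟩, ?_⟩
  · have h1 := hB.lt_hammingNorm_add hvB hv0
    have h2 : hammingNorm v = n + 1 - l := by convert hvw
    omega
  · rintro _ ⟨u, ⟨hu, huB⟩, rfl⟩
    exact hle ⟨u, ⟨hu, fun h => huB (h ▸ B.zero_mem)⟩, rfl⟩

end MinDist

/-! ### CSS codes -/

section CSS

variable {F : Type*} [Field F] [Fintype F] {n : ℕ}

open Classical in
lemma cosetState_apply (D : Submodule F (Fin n → F)) (x z : Fin n → F) :
    cosetState D x z = if z - x ∈ D then 1 else 0 := by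
  simp [cosetState, Set.indicator_apply]

lemma cosetState_eq {D : Submodule F (Fin n → F)} {x y : Fin n → F} (h : x - y ∈ D) :
    cosetState D x = cosetState D y := by
  classical
  ext z
  rw [cosetState_apply, cosetState_apply]
  congr 1
  rw [← sub_add_sub_cancel z x y, D.add_mem_iff_left h]

lemma inner_cosetState_eq_zero {D : Submodule F (Fin n → F)} {x y : Fin n → F}
    (h : x - y ∉ D) : inner ℂ (cosetState D x) (cosetState D y) = 0 := by
  classical
  rw [PiLp.inner_apply]
  refine sum_eq_zero fun z _ => ?_
  rw [cosetState_apply, cosetState_apply]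
  by_cases hx : z - x ∈ D
  · have hy : z - y ∉ D := fun hy => h (by simpa using D.sub_mem hy hx)
    simp [hy]
  · simp [hx]

lemma cosetState_ne_zero (D : Submodule F (Fin n → F)) (x : Fin n → F) : cosetState D x ≠ 0 := by
  classical
  intro h
  have := congrArg (fun φ : QuditSpace F n => φ x) h
  simp [cosetState_apply] at this

/-- The coset states are pairwise orthogonal, so the dimension of a CSS code is the number of cosets
of `C₁^⊥` in `C₂`. -/
lemma finrank_cssCode {C₁ C₂ : Submodule F (Fin n → F)} {j : ℕ} (h : dualCode C₁ ≤ C₂)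
    (hdim : finrank F C₁ + finrank F C₂ = n + j) :
    finrank ℂ (cssCode C₁ C₂) = Fintype.card F ^ j := by
  classical
  set D := dualCode C₁
  have hDk : finrank F D = n - finrank F C₁ := finrank_dualCode C₁
  let v : (C₂ ⧸ D.submoduleOf C₂) → QuditSpace F n := fun t => cosetState D (t.out : C₂)
  have hspan : cssCode C₁ C₂ = Submodule.span ℂ (Set.range v) := by
    refine congrArg (Submodule.span ℂ) (Set.Subset.antisymm ?_ ?_)
    · rintro _ ⟨x, hx, rfl⟩
      refine ⟨Submodule.Quotient.mk ⟨x, hx⟩, cosetState_eq ?_⟩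
      exact (Submodule.Quotient.eq (D.submoduleOf C₂)).1 (Quotient.out_eq _)
    · rintro _ ⟨t, rfl⟩
      exact ⟨_, t.out.2, rfl⟩
  have hli : LinearIndependent ℂ v := by
    refine linearIndependent_of_ne_zero_of_inner_eq_zero (fun t => cosetState_ne_zero _ _) ?_
    intro s t hst
    refine inner_cosetState_eq_zero fun hmem => hst ?_
    rw [← Quotient.out_eq s, ← Quotient.out_eq t]
    exact (Submodule.Quotient.eq (D.submoduleOf C₂)).2 hmem
  have : Fintype (C₂ ⧸ D.submoduleOf C₂) := Fintype.ofFinite _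
  rw [hspan, finrank_span_eq_card hli, Module.card_eq_pow_finrank (K := F)]
  congr 1
  have h1 := (D.submoduleOf C₂).finrank_quotient_add_finrank
  rw [(Submodule.submoduleOfEquivOfLe h).finrank_eq, hDk] at h1
  have h2 := finrank_le_card C₁
  rw [Fintype.card_fin] at h2
  omega

lemma apply_eq_zero_of_mem_cssCode {C₁ C₂ : Submodule F (Fin n → F)} (h : dualCode C₁ ≤ C₂)
    {φ : QuditSpace F n} (hφ : φ ∈ cssCode C₁ C₂) {z : Fin n → F} (hz : z ∉ C₂) : φ z = 0 := by
  classical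
  induction hφ using Submodule.span_induction with
  | mem φ hφ =>
    obtain ⟨x, hx, rfl⟩ := hφ
    rw [cosetState_apply, if_neg]
    exact fun hzx => hz (by simpa using C₂.add_mem (h hzx) hx)
  | zero => rfl
  | add φ ψ _ _ hφ hψ => simp [hφ, hψ]
  | smul c φ _ hφ => simp [hφ]

lemma apply_add_of_mem_cssCode {C₁ C₂ : Submodule F (Fin n → F)} {φ : QuditSpace F n}
    (hφ : φ ∈ cssCode C₁ C₂) {d : Fin n → F} (hd : d ∈ dualCode C₁) (z : Fin n → F) :
    φ (z + d) = φ z := by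
  classical
  induction hφ using Submodule.span_induction with
  | mem φ hφ =>
    obtain ⟨x, -, rfl⟩ := hφ
    rw [cosetState_apply, cosetState_apply]
    congr 1
    rw [add_sub_right_comm, (dualCode C₁).add_mem_iff_left hd]
  | zero => rfl
  | add φ ψ _ _ hφ hψ => simp [hφ, hψ]
  | smul c φ _ hφ => simp [hφ]

/-- An `X`-error outside `C₂` moves the code to states with disjoint support. -/
lemma inner_errorOp_eq_zero_of_notMem {C₁ C₂ : Submodule F (Fin n → F)} (h : dualCode C₁ ≤ C₂)
    (χ : AddChar F ℂ) {a : Fin n → F} (ha : a ∉ C₂) (b : Fin n → F) {φ ψ : QuditSpace F n}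
    (hφ : φ ∈ cssCode C₁ C₂) (hψ : ψ ∈ cssCode C₁ C₂) :
    inner ℂ φ (errorOp χ a b ψ) = 0 := by
  rw [PiLp.inner_apply]
  refine sum_eq_zero fun z _ => ?_
  by_cases hz : z ∈ C₂
  · have : z - a ∉ C₂ := fun hza => ha (by simpa using C₂.sub_mem hz hza)
    simp [errorOp, apply_eq_zero_of_mem_cssCode h hψ this]
  · simp [apply_eq_zero_of_mem_cssCode h hφ hz]

/-- A `Z`-error outside `C₁` maps the code into its orthogonal complement: some translation by a
word of `C₁^⊥`, which fixes the states of the code, multiplies the inner product by a scalar different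
from `1`. -/
lemma inner_errorOp_zero_eq_zero_of_notMem {C₁ C₂ : Submodule F (Fin n → F)} {χ : AddChar F ℂ}
    (hχ : χ ≠ 1) {b : Fin n → F} (hb : b ∉ C₁) {φ ψ : QuditSpace F n}
    (hφ : φ ∈ cssCode C₁ C₂) (hψ : ψ ∈ cssCode C₁ C₂) :
    inner ℂ φ (errorOp χ 0 b ψ) = 0 := by
  obtain ⟨y, hy⟩ := AddChar.ne_one_iff.1 hχ
  obtain ⟨d, hd, hbd⟩ : ∃ d ∈ dualCode C₁, b ⬝ᵥ d ≠ 0 := by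
    by_contra! hcon
    rw [← dualCode_dualCode C₁] at hb
    exact hb hcon
  set e := (y / (b ⬝ᵥ d)) • d with he
  have heD : e ∈ dualCode C₁ := (dualCode C₁).smul_mem _ hd
  have hbe : b ⬝ᵥ e = y := by rw [he, dotProduct_smul, smul_eq_mul, div_mul_cancel₀ _ hbd]
  set G : (Fin n → F) → ℂ := fun z => inner ℂ (φ z) (χ (b ⬝ᵥ z) * ψ z) with hG
  have hinner : inner ℂ φ (errorOp χ 0 b ψ) = ∑ z, G z := by
    rw [PiLp.inner_apply]
    simp [errorOp, hG]
  have hshift : ∀ z, G (z + e) = χ y * G z := fun z => by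
    simp only [hG, apply_add_of_mem_cssCode hφ heD, apply_add_of_mem_cssCode hψ heD, dotProduct_add,
      hbe, AddChar.map_add_eq_mul, RCLike.inner_apply]
    ring
  have hsum : χ y * ∑ z, G z = ∑ z, G z := by
    rw [mul_sum, ← Equiv.sum_comp (Equiv.addRight e) G]
    exact sum_congr rfl fun z _ => (hshift z).symm
  rw [hinner]
  have : (χ y - 1) * ∑ z, G z = 0 := by rw [sub_mul, hsum, one_mul, sub_self]
  exact (mul_eq_zero.1 this).resolve_left (sub_ne_zero.2 hy)

open Classical in
/-- A CSS code detects, as a pure code, all `X`-errors of weight less than the minimum distance of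
`C₂` together with all `Z`-errors of weight less than the minimum distance of `C₁`. -/
lemma isAQC_cssCode {C₁ C₂ : Submodule F (Fin n → F)} {j dz dx : ℕ} (h : dualCode C₁ ≤ C₂)
    (hdim : finrank F C₁ + finrank F C₂ = n + j) (hdx : 1 ≤ dx) (hdz : 1 ≤ dz)
    (hX : ∀ a ∈ C₂, a ≠ 0 → dx ≤ hammingNorm a) (hZ : ∀ b ∈ C₁, b ≠ 0 → dz ≤ hammingNorm b) :
    IsAQC (cssCode C₁ C₂) j dz dx := by
  have hpure : ∀ χ : AddChar F ℂ, χ ≠ 1 → ∀ a b : Fin n → F,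
      hammingNorm a ≤ dx - 1 → hammingNorm b ≤ dz - 1 → (a ≠ 0 ∨ b ≠ 0) →
        ∀ φ ∈ cssCode C₁ C₂, ∀ ψ ∈ cssCode C₁ C₂, inner ℂ φ (errorOp χ a b ψ) = 0 := by
    intro χ hχ a b ha hb hab φ hφ ψ hψ
    by_cases ha0 : a = 0
    · subst ha0
      have hb0 := hab.resolve_left (by simp)
      refine inner_errorOp_zero_eq_zero_of_notMem hχ (fun hbC => ?_) hφ hψ
      have := hZ b hbC hb0
      omega
    · refine inner_errorOp_eq_zero_of_notMem h χ (fun haC => ?_) b hφ hψ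
      have := hX a haC ha0
      omega
  refine ⟨hdx, hdz, finrank_cssCode h hdim, fun χ hχ a b ha hb => ?_, fun _ => hpure⟩
  by_cases hab : a ≠ 0 ∨ b ≠ 0
  · exact ⟨0, fun φ hφ ψ hψ => by rw [hpure χ hχ a b ha hb hab φ hφ ψ hψ, zero_mul]⟩
  · obtain ⟨rfl, rfl⟩ : a = 0 ∧ b = 0 := by simpa using hab
    exact ⟨1, fun φ _ ψ _ => by simp [errorOp]⟩

end CSS

/-! ### Pure CSS AQMDS codes and nested MDS codes -/

section Reduction

variable {F : Type*} [Field F] [Fintype F] {n : ℕ}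

/-- The quantum Singleton bound is the sum of the classical Singleton bounds of `C₁` and `C₂`, so
equality forces both codes to be MDS; conversely, nested MDS codes `B ≤ A` give the pure CSS code of
`C₁ = B^⊥` and `C₂ = A`. -/
lemma exists_isPureCSSAQMDS_iff {k j : ℕ} (hk : 0 < k) :
    (∃ dz dx : ℕ, ({(dz : ℤ), (dx : ℤ)} : Set ℤ) = {(n : ℤ) - k - j + 1, (k : ℤ) + 1} ∧
        ∃ Q : Submodule ℂ (QuditSpace F n), IsPureCSSAQMDS Q j dz dx) ↔
      k < n ∧ HasNestedMDS F (Fin n) k (k + j) := by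
  classical
  constructor
  · rintro ⟨dz, dx, hd, Q, ⟨C₁, C₂, hcss, d₁, d₂, h₁, h₂, hpure⟩, hj⟩
    have hs₁ := h₁.add_finrank_le
    have hs₂ := h₂.add_finrank_le
    have hp₁ := h₁.finrank_pos
    have hp₂ := h₂.finrank_pos
    have hdim := hcss.dim_eq
    have hsum : dz + dx = d₁ + d₂ := by
      rcases Set.pair_eq_pair_iff.1 hpure with h | h <;> omega
    have hset : ((d₁ : ℤ) = k + 1 ∧ (d₂ : ℤ) = n - k - j + 1) ∨
        ((d₂ : ℤ) = k + 1 ∧ (d₁ : ℤ) = n - k - j + 1) := by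
      rcases Set.pair_eq_pair_iff.1 hpure with h | h <;>
        rcases Set.pair_eq_pair_iff.1 hd with h' | h' <;> omega
    have hle' : dualCode C₂ ≤ C₁ := by
      have := euclideanDual_anti hcss.dual_le
      rwa [← dualCode_eq_euclideanDual, ← dualCode_eq_euclideanDual, dualCode_dualCode] at this
    have hdual : ∀ {C : Submodule F (Fin n → F)}, IsMDSOfDim C (n - k) → k < n →
        IsMDSOfDim (dualCode C) k := fun hC hkn => by
      have := hC.euclideanDual
      rwa [← dualCode_eq_euclideanDual, Fintype.card_fin, Nat.sub_sub_self hkn.le] at this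
    have hkn : k < n := by omega
    refine ⟨hkn, ?_⟩
    rcases hset with h | h
    · exact ⟨dualCode C₁, C₂, hcss.dual_le,
        hdual (h₁.isMDSOfDim (by omega) (by omega)) hkn, h₂.isMDSOfDim (by omega) (by omega)⟩
    · exact ⟨dualCode C₂, C₁, hle',
        hdual (h₂.isMDSOfDim (by omega) (by omega)) hkn, h₁.isMDSOfDim (by omega) (by omega)⟩
  · rintro ⟨hkn, B, A, hBA, hB, hA⟩
    have hkj := hA.le_card
    rw [Fintype.card_fin] at hkj
    have hB' := hB.euclideanDual
    have hA' := hA.euclideanDual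
    rw [← dualCode_eq_euclideanDual, Fintype.card_fin] at hB' hA'
    have hle : dualCode A ≤ dualCode B := by
      rw [dualCode_eq_euclideanDual, dualCode_eq_euclideanDual]
      exact euclideanDual_anti hBA
    have hdd := dualCode_dualCode B
    set w₂ := n + 1 - (k + j) with hw₂
    set w₁ := n + 1 - (n - k) with hw₁
    have hdim : finrank F (dualCode B) + finrank F A = n + j := by rw [hB'.1, hA.1]; omega
    have hd₂ : HasMinDist A w₂ := hA.hasMinDist (by omega)
    have hd₁ : HasMinDist (dualCode B) w₁ := hB'.hasMinDist (by omega)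
    have hX : ∀ a ∈ A, a ≠ 0 → w₂ ≤ hammingNorm a := fun a ha ha0 => by
      have := hA.lt_hammingNorm_add ha ha0
      omega
    have hZ : ∀ a ∈ dualCode B, a ≠ 0 → w₁ ≤ hammingNorm a := fun a ha ha0 => by
      have := hB'.lt_hammingNorm_add ha ha0
      omega
    have hc₂ : HasCosetWeight A (dualCode (dualCode B)) w₂ := by
      rw [hdd]; exact hasCosetWeight_of_isMDSOfDim hBA hB hA (by omega)
    have hc₁ : HasCosetWeight (dualCode B) (dualCode A) w₁ :=
      hasCosetWeight_of_isMDSOfDim hle hA' hB' (by omega)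
    have hz₁ : (w₁ : ℤ) = k + 1 := by omega
    have hz₂ : (w₂ : ℤ) = n - k - j + 1 := by omega
    -- the code with the larger minimum distance has to take care of the `Z`-errors
    rcases le_total w₂ w₁ with hw | hw
    · refine ⟨w₁, w₂, by rw [hz₁, hz₂, Set.pair_comm], cssCode (dualCode B) A,
        ⟨dualCode B, A, ⟨hdd.trans_le hBA, hdim, ⟨w₁, w₂, hc₂, hc₁, ?_, ?_⟩, .inl rfl, ?_⟩,
          w₁, w₂, hd₁, hd₂, rfl⟩, by omega⟩
      · rw [max_eq_right hw]
      · rw [min_eq_left hw]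
      · exact isAQC_cssCode (hdd.trans_le hBA) hdim (by omega) (by omega) hX hZ
    · refine ⟨w₂, w₁, by rw [hz₁, hz₂], cssCode A (dualCode B),
        ⟨dualCode B, A, ⟨hdd.trans_le hBA, hdim, ⟨w₁, w₂, hc₂, hc₁, ?_, ?_⟩, .inr rfl, ?_⟩,
          w₁, w₂, hd₁, hd₂, Set.pair_comm _ _⟩, by omega⟩
      · rw [max_eq_left hw]
      · rw [min_eq_right hw]
      · exact isAQC_cssCode hle (by omega) (by omega) (by omega) hZ hX

end Reduction

/-! ### Consequences of the MDS conjecture -/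

section Conjecture

variable {F : Type*} [Field F]

lemma CodeEquiv.finrank_eq {n : ℕ} {C D : Submodule F (Fin n → F)} (h : CodeEquiv C D) :
    finrank F C = finrank F D := by
  obtain ⟨σ, a, h⟩ := h
  have hinj : Function.Injective (monomialMap (F := F) σ fun i => (a i : F)) :=
    monomialMap_injective σ.surjective fun i => (a i).ne_zero
  have hmap : C.map (monomialMap σ fun i => (a i : F)) = D := by
    ext y
    obtain ⟨x, rfl⟩ := LinearMap.injective_iff_surjective.1 hinj y
    exact (hinj.mem_set_image (s := (C : Set (Fin n → F)))).trans (h x)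
  rw [← hmap]
  exact (C.equivMapOfInjective _ hinj).finrank_eq

lemma IsTrivialCode.finrank_eq {n : ℕ} (hn : 0 < n) {C : Submodule F (Fin n → F)}
    (h : IsTrivialCode C) : finrank F C = n ∨ finrank F C = 1 ∨ finrank F C = n - 1 := by
  have hrep : finrank F (repetitionCode F n) = 1 :=
    finrank_span_singleton fun h => one_ne_zero (congrFun h ⟨0, hn⟩)
  rcases h with rfl | h | h
  · left; simp
  · right; left; rw [h.finrank_eq, hrep]
  · right; right; rw [h.finrank_eq, finrank_dualCode, hrep]

lemma MDSConjecture.card_index_le [Fintype F] (hMDS : MDSConjecture F) {ι : Type*} [Fintype ι]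
    {C : Submodule F (ι → F)} {k : ℕ} (hC : IsMDSOfDim C k) (hk : 2 ≤ k)
    (hk' : k + 2 ≤ Fintype.card ι) :
    Fintype.card ι ≤ Fintype.card F + 1 ∨ (Even (Fintype.card F) ∧
      (k = 3 ∨ k = Fintype.card F - 1) ∧ Fintype.card ι ≤ Fintype.card F + 2) := by
  set n := Fintype.card ι with hn
  have hD := hC.map_monomialMap (Fintype.equivFin ι).symm fun _ => one_ne_zero
  set D := C.map (monomialMap (Fintype.equivFin ι).symm fun _ => 1)
  have htriv : ¬ IsTrivialCode D := fun h => by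
    have := h.finrank_eq (by omega)
    rw [hD.1] at this
    omega
  have hmds : IsMDS D := ⟨_, hD.hasMinDist (by omega), by rw [hD.1]; omega⟩
  have := hMDS n k D hmds htriv hD.1
  tauto

lemma exists_card_eq_two_pow [Fintype F] (h : Even (Fintype.card F)) :
    ∃ m : ℕ, 1 ≤ m ∧ Fintype.card F = 2 ^ m := by
  obtain ⟨p, -, m, hp, hm⟩ := FiniteField.card' F
  rw [hm] at h
  obtain rfl : 2 = p := (Nat.prime_dvd_prime_iff_eq Nat.prime_two hp).1
    (Nat.prime_two.dvd_of_dvd_pow h.two_dvd)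
  exact ⟨m, m.pos, hm⟩

lemma two_eq_zero_of_card [Fintype F] {m : ℕ} (h : Fintype.card F = 2 ^ m) : (2 : F) = 0 := by
  have := FiniteField.cast_card_eq_zero F
  rw [h] at this
  push_cast at this
  exact eq_zero_of_pow_eq_zero this

/-- Over `𝔽₂` the only word without zeros is the all-one word, so codes of dimension `1` and
codimension `1` are nested only if the length is even. -/
lemma HasNestedMDS.even_card [Fintype F] (hF : Fintype.card F = 2) {ι : Type*} [Fintype ι]
    (h : HasNestedMDS F ι 1 (Fintype.card ι - 1)) (hι : 0 < Fintype.card ι) :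
    Even (Fintype.card ι) := by
  classical
  have hone : ∀ {C : Submodule F (ι → F)}, IsMDSOfDim C 1 → (1 : ι → F) ∈ C := by
    intro C hC
    obtain ⟨v, hv, hv0, -⟩ := exists_ne_zero_vanishing C ∅ (by rw [hC.1]; simp)
    suffices v = 1 from this ▸ hv
    ext i
    have hi : v i ≠ 0 := fun hi => hv0 (hC.2 v hv {i} (by simp) (by simpa using hi))
    simpa [hF] using FiniteField.pow_card_sub_one_eq_one (v i) hi
  obtain ⟨B, A, hBA, hB, hA⟩ := h
  have hA' := hA.euclideanDual
  rw [Nat.sub_sub_self hι] at hA'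
  have h1 := mem_euclideanDual.1 (hone hA') 1 (hBA (hone hB))
  have hchar : CharP F 2 := by
    have h2 : (2 : F) = 0 := two_eq_zero_of_card (m := 1) (by simpa using hF)
    exact CharTwo.of_one_ne_zero_of_two_eq_zero one_ne_zero h2
  rw [even_iff_two_dvd, ← CharP.cast_eq_zero_iff F 2]
  simpa [dotProduct] using h1

end Conjecture

/-! ### The classification -/

section Classification

variable {F : Type*} [Field F] [Fintype F]

/-- The parameters `[[n, j, dz / dx]]_q` with `{dz, dx} = {n - k - j + 1, k + 1}` for which pure CSS
AQMDS codes exist when the MDS conjecture holds. -/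
def AdmissibleParameters (q n k j : ℕ) : Prop :=
  (2 ≤ n ∧ (k = 1 ∨ k = n - 1) ∧ (j = 0 ∨ j = n - k)) ∨
    (q = 2 ∧ Even n ∧ k = 1 ∧ j = n - 2) ∨
    (3 ≤ q ∧ 2 ≤ n ∧ k = 1 ∧ j = n - 2) ∨
    (3 ≤ q ∧ 2 ≤ n ∧ n ≤ q ∧ k ≤ n - 1 ∧ j ≤ n - k) ∨
    (3 ≤ q ∧ n = q + 1 ∧ k ≤ n - 1 ∧ (j = 0 ∨ (2 ≤ j ∧ j ≤ n - k))) ∨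
    (∃ m : ℕ, 1 ≤ m ∧ q = 2 ^ m ∧ n = q + 1 ∧ j = 1 ∧ (k = 2 ∨ k = 2 ^ m - 2)) ∨
    (∃ m : ℕ, 2 ≤ m ∧ q = 2 ^ m ∧ n = q + 2 ∧
      ((k = 1 ∧ (j = 2 ∨ j = 2 ^ m - 2)) ∨
        (k = 3 ∧ (j = 0 ∨ j = 2 ^ m - 4 ∨ j = 2 ^ m - 2 ∨ j = 2 ^ m - 1)) ∨
        (k = 2 ^ m - 1 ∧ (j = 0 ∨ j = 2 ∨ j = 3))))

/-- The smaller and the larger code both obey the MDS conjecture, which leaves few dimensions when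
`n ≥ q + 2`. For `n = q + 1` and `j = 1`, the conjecture is applied to the code of length `q + 2`
from `exists_isMDSOfDim_option`. Over `𝔽₂`, `IsMDSOfDim.card_index_le` replaces the conjecture. -/
lemma parameters_of_hasNestedMDS {q n k j : ℕ} (hq : Fintype.card F = q) (hMDS : MDSConjecture F)
    (hk : 0 < k) (hkn : k < n) (h : HasNestedMDS F (Fin n) k (k + j)) :
    AdmissibleParameters q n k j := by
  subst hq
  set q := Fintype.card F with hq
  have hq2 : 2 ≤ q := Fintype.one_lt_card
  obtain ⟨B, A, hBA, hB, hA⟩ := id h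
  have hkj : k + j ≤ n := by simpa using hA.le_card
  rcases hq2.eq_or_lt with hq2 | hq3
  · have hB2 := hB.card_index_le
    have hA2 := hA.card_index_le
    rw [Fintype.card_fin, ← hq, ← hq2] at hB2 hA2
    by_cases hpar : k = 1 ∧ k + j = n - 1
    · have := HasNestedMDS.even_card hq2.symm (ι := Fin n)
        (by rw [Fintype.card_fin, ← hpar.2]; exact hpar.1 ▸ h) (by simp; omega)
      rw [Fintype.card_fin] at this
      exact .inr (.inl ⟨hq2.symm, this, hpar.1, by omega⟩)
    · left; omega
  rcases le_or_gt n q with hnq | hnq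
  · exact .inr (.inr (.inr (.inl ⟨hq3, by omega, hnq, by omega, by omega⟩)))
  rcases (Nat.succ_le_of_lt hnq).eq_or_lt with hn | hnq
  · by_cases hj : j = 1 ∧ k < q
    · obtain ⟨rfl, hkq⟩ := hj
      obtain ⟨C, hC⟩ := exists_isMDSOfDim_option hBA hB hA (by simpa using hkj)
      have hCc := hMDS.card_index_le hC (by omega) (by simp; omega)
      rw [Fintype.card_option, Fintype.card_fin, ← hq] at hCc
      rcases hCc with hCc | ⟨heven, hCk, -⟩
      · omega
      obtain ⟨m, hm, hqm⟩ := exists_card_eq_two_pow heven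
      have hodd := Nat.even_iff.1 heven
      refine .inr (.inr (.inr (.inr (.inr (.inl ⟨m, hm, hqm, hn.symm, rfl, ?_⟩)))))
      rw [← hqm, ← hq]
      omega
    · by_cases hj' : k = q ∧ j = 1
      · exact .inl (by omega)
      · exact .inr (.inr (.inr (.inr (.inl ⟨hq3, hn.symm, by omega, by omega⟩))))
  have hBc := hMDS.card_index_le hB
  have hAc := hMDS.card_index_le hA
  rw [Fintype.card_fin, ← hq] at hBc hAc
  have hBc : k = 1 ∨ k = n - 1 ∨ (Even q ∧ n = q + 2 ∧ (k = 3 ∨ k = q - 1)) := by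
    by_contra! hcon
    rcases hBc (by omega) (by omega) with h | ⟨h1, h2, h3⟩
    · omega
    · have := hcon.2.2 h1 (by omega)
      omega
  have hAc : k + j = 1 ∨ k + j = n - 1 ∨ k + j = n ∨
      (Even q ∧ n = q + 2 ∧ (k + j = 3 ∨ k + j = q - 1)) := by
    by_contra! hcon
    rcases hAc (by omega) (by omega) with h | ⟨h1, h2, h3⟩
    · omega
    · have := hcon.2.2.2 h1 (by omega)
      omega
  by_cases h1 : (k = 1 ∨ k = n - 1) ∧ (j = 0 ∨ j = n - k)
  · exact .inl ⟨by omega, h1⟩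
  by_cases h3 : k = 1 ∧ j = n - 2
  · exact .inr (.inr (.inl ⟨hq3, by omega, h3⟩))
  obtain ⟨hn, heven⟩ : n = q + 2 ∧ Even q := by
    rcases hBc with hBc | hBc | hBc
    · rcases hAc with hAc | hAc | hAc | hAc
      · omega
      · omega
      · omega
      · exact ⟨hAc.2.1, hAc.1⟩
    · omega
    · exact ⟨hBc.2.1, hBc.1⟩
  obtain ⟨m, hm, hqm⟩ := exists_card_eq_two_pow heven
  have hm2 : 2 ≤ m := by
    by_contra hm2
    obtain rfl : m = 1 := by omega
    omega
  refine .inr (.inr (.inr (.inr (.inr (.inr ⟨m, hm2, hqm, hn, ?_⟩)))))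
  rw [← hqm, ← hq]
  have hqe : q % 2 = 0 := Nat.even_iff.1 heven
  simp only [heven, hn, true_and] at hBc hAc
  omega

/-- Every admissible case is realized by one of the constructions above or by its dual. -/
lemma hasNestedMDS_of_parameters {q n k j : ℕ} (hq : Fintype.card F = q) (hn : 0 < n) (hk : 0 < k)
    (h : AdmissibleParameters q n k j) :
    k < n ∧ HasNestedMDS F (Fin n) k (k + j) := by
  subst hq
  set q := Fintype.card F with hq
  have hne : Nonempty (Fin n) := ⟨⟨0, hn⟩⟩
  -- dualize nested codes over any index type of the right size
  have hdual : ∀ {ι : Type _} [Fintype ι] {k' l' : ℕ}, Fintype.card ι = n →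
      HasNestedMDS F ι k' l' → n - l' = k → n - k' = k + j → HasNestedMDS F (Fin n) k (k + j) := by
    intro ι _ k' l' hc hnest hl' hl
    have := (hnest.congr (κ := Fin n) (by simp [hc])).euclideanDual
    rwa [Fintype.card_fin, hl, hl'] at this
  rcases h with ⟨h2n, hk1, hj⟩ | ⟨hq2, heven, rfl, rfl⟩ | ⟨hq3, h2n, rfl, rfl⟩ |
    ⟨hq3, h2n, hnq, hkn, hj⟩ | ⟨hq3, rfl, hkn, hj⟩ | ⟨m, hm, hqm, rfl, rfl, hkm⟩ |
    ⟨m, hm, hqm, rfl, hkj⟩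
  · refine ⟨by omega, ?_⟩
    obtain ⟨C, hC⟩ : ∃ C : Submodule F (Fin n → F), IsMDSOfDim C k := by
      have h1 : IsMDSOfDim (Submodule.span F {(1 : Fin n → F)}) 1 :=
        isMDSOfDim_span_singleton fun _ => one_ne_zero
      rcases hk1 with rfl | rfl
      · exact ⟨_, h1⟩
      · exact ⟨_, by simpa using h1.euclideanDual⟩
    rcases hj with rfl | rfl
    · exact hC.hasNestedMDS_self
    · rw [Nat.add_sub_cancel' (by omega)]
      simpa using hC.hasNestedMDS_top
  · have h2n : 2 ≤ n := by
      obtain ⟨r, hr⟩ := heven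
      omega
    refine ⟨by omega, ?_⟩
    have h2 : (2 : F) = 0 := two_eq_zero_of_card (m := 1) (by simpa using hq2)
    have := hasNestedMDS_one_pred (u := (1 : Fin n → F)) (fun _ => one_ne_zero) (by
      obtain ⟨r, rfl⟩ := heven
      simp [← two_mul, h2])
    rwa [Fintype.card_fin, show n - 1 = 1 + (n - 2) by omega] at this
  · refine ⟨by omega, ?_⟩
    obtain ⟨n, rfl⟩ := Nat.exists_eq_add_of_le' h2n
    obtain ⟨u, hu, hs⟩ := exists_ne_zero_sum_eq hq3 n 0
    have := hasNestedMDS_one_pred hu hs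
    rwa [Fintype.card_fin, show n + 2 - 1 = 1 + (n + 2 - 2) by omega] at this
  · exact ⟨by omega, hasNestedMDS_of_card_le (by simpa using hnq) (by omega) (by simp; omega)⟩
  · exact ⟨by omega, (hasNestedMDS_option hk (by omega) (by omega)).congr (by simp [hq])⟩
  · have h23 := hasNestedMDS_option_two_three (two_eq_zero_of_card hqm)
    rw [← hqm] at hkm
    have hq2 : 2 ≤ q := Fintype.one_lt_card
    refine ⟨by omega, ?_⟩
    rcases hkm with rfl | rfl
    · exact h23.congr (by simp [hq])
    · exact hdual (by simp [hq]) h23 (by omega) (by omega)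
  · have h2 := two_eq_zero_of_card hqm
    have hq4 : 4 ≤ q := hqm ▸ Nat.pow_le_pow_right (n := 2) (by norm_num) hm
    rw [← hqm] at hkj
    have hcard : Fintype.card (Option (Option F)) = q + 2 := by simp [hq]
    have hcard' : Fintype.card (Fin (q + 2)) = Fintype.card (Option (Option F)) := by simp [hq]
    have hH := isMDSOfDim_hyperoval h2
    have h13 := hasNestedMDS_hyperoval_one_three h2
    have h1q := hasNestedMDS_hyperoval_one h2 hq4
    rcases hkj with ⟨rfl, rfl | rfl⟩ | ⟨rfl, rfl | rfl | rfl | rfl⟩ | ⟨rfl, rfl | rfl | rfl⟩ <;>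
      refine ⟨by omega, ?_⟩
    · exact h13.congr hcard'
    · rw [show 1 + (q - 2) = q - 1 by omega]
      exact h1q.congr hcard'
    · exact hH.hasNestedMDS_self.congr hcard'
    · rw [show 3 + (q - 4) = q - 1 by omega]
      rcases eq_or_ne q 4 with h4 | h4
      · rw [show q - 1 = 3 by omega]
        exact hH.hasNestedMDS_self.congr hcard'
      · have hm3 : 3 ≤ m := by
          by_contra hm3
          obtain rfl : m = 2 := by omega
          exact h4 hqm
        have hq8 : 8 ≤ q := hqm ▸ Nat.pow_le_pow_right (n := 2) (by norm_num) hm3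
        exact (hasNestedMDS_hyperoval_three h2 hq8).congr hcard'
    · exact hdual hcard h1q (by omega) (by omega)
    · rw [show 3 + (q - 1) = Fintype.card (Option (Option F)) by omega]
      exact hH.hasNestedMDS_top.congr hcard'
    · exact hdual hcard hH.hasNestedMDS_self (by omega) (by omega)
    · exact hdual hcard h13 (by omega) (by omega)
    · have := hH.euclideanDual.hasNestedMDS_top
      rw [hcard, show q + 2 - 3 = q - 1 by omega] at this
      rw [show q - 1 + 3 = q + 2 by omega]
      exact this.congr hcard'

end Classification

theorem mainTheorem1 {F : Type*} [Field F] [Fintype F] (q : ℕ) (hq : Fintype.card F = q)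
    (hMDS : MDSConjecture F) (n k j : ℕ) (hn : 0 < n) (hk : 0 < k) :
    (∃ dz dx : ℕ,
        ({(dz : ℤ), (dx : ℤ)} : Set ℤ) = {(n : ℤ) - k - j + 1, (k : ℤ) + 1} ∧
        ∃ Q : Submodule ℂ (QuditSpace F n), IsPureCSSAQMDS Q j dz dx) ↔
      ((2 ≤ n ∧ (k = 1 ∨ k = n - 1) ∧ (j = 0 ∨ j = n - k)) ∨
       (q = 2 ∧ Even n ∧ k = 1 ∧ j = n - 2) ∨
       (3 ≤ q ∧ 2 ≤ n ∧ k = 1 ∧ j = n - 2) ∨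
       (3 ≤ q ∧ 2 ≤ n ∧ n ≤ q ∧ k ≤ n - 1 ∧ j ≤ n - k) ∨
       (3 ≤ q ∧ n = q + 1 ∧ k ≤ n - 1 ∧ (j = 0 ∨ (2 ≤ j ∧ j ≤ n - k))) ∨
       (∃ m : ℕ, 1 ≤ m ∧ q = 2 ^ m ∧ n = q + 1 ∧ j = 1 ∧ (k = 2 ∨ k = 2 ^ m - 2)) ∨
       (∃ m : ℕ, 2 ≤ m ∧ q = 2 ^ m ∧ n = q + 2 ∧
         ((k = 1 ∧ (j = 2 ∨ j = 2 ^ m - 2)) ∨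
          (k = 3 ∧ (j = 0 ∨ j = 2 ^ m - 4 ∨ j = 2 ^ m - 2 ∨ j = 2 ^ m - 1)) ∨
          (k = 2 ^ m - 1 ∧ (j = 0 ∨ j = 2 ∨ j = 3))))) := by
  rw [exists_isPureCSSAQMDS_iff hk]
  exact ⟨fun h => parameters_of_hasNestedMDS hq hMDS hk h.1 h.2,
    hasNestedMDS_of_parameters hq hn hk⟩
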